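/- Let $A\in\mathbb{C}^{n\times n}$ have index $k\ge 1$, where the index of $A$ is the smallest integer $j\ge 0$ with $\operatorname{rk}(A^{j})=\operatorname{rk}(A^{j+1})$. Write $A^*$ for the conjugate transpose, $A^\dagger$ for the Moore--Penrose inverse, $P_A=AA^\dagger$, $Q_A=A^\dagger A$, and $A^d$ for the Drazin inverse, that is, the unique $X$ with $XAX=X$, $AX=XA$, $XA^{k+1}=A^k$. Define the following generalized inverses of $A$: - core EP inverse $A^{\oplus}:=A^k(A^{k+1})^\dagger$; - DMP inverse $A^{d,\dagger}:=A^dP_A$, dual DMP inverse $A^{\dagger,d}:=Q_AA^d$, CMP inverse $A^{c,\dagger}:=Q_AA^{d,\dagger}$; - weak group inverse $A^{w}:=(A^{\oplus})^2A$; - MPCEP inverse $A^{\dagger,\oplus}:=Q_AA^{\oplus}$; - weak core (WC) inverse $A^{w,\dagger}:=A^{w}P_A$, dual WC inverse $A^{\dagger,w}:=Q_AA^{w}$. Let $$A=U\begin{bmatrix}T&S\\0&N\end{bmatrix}U^*$$ be any core EP decomposition of $A$, that is, $U\in\mathbb{C}^{n\times n}$ is unitary, $T\in\mathbb{C}^{t\times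 t}$ is nonsingular with $t=\operatorname{rk}(A^k)$, and $N\in\mathbb{C}^{(n-t)\times(n-t)}$ is nilpotent of index $k$ (that is, $k$ is the least exponent $j$ with $N^j=0$). For $j\ge1$ put $\tilde T_j=\sum_{i=0}^{j-1}T^iSN^{j-1-i}$. Then for every integer $m\ge1$ the following fifteen conditions are equivalent: (a) $A$ is $k$-core EP: $A^kA^{\oplus}=A^{\oplus}A^k$; (b) $A$ is $k$-index EP: $A^k(A^k)^\dagger=(A^k)^\dagger A^k$; (c) $A$ is $\{m,k\}$-core EP: $A^mA^{\oplus}=A^{\oplus}A^m$ (for the given, arbitrary, $m$); (d) $A$ is $k$-MPCEP: $A^kA^{\dagger,\oplus}=A^{\dagger,\oplus}A^k$; (e) $A$ is both $k$-WC and dual $k$-WC: $A^kA^{w,\dagger}=A^{w,\dagger}A^k$ and $A^kA^{\dagger,w}=A^{\dagger,w}A^k$; (f) $A^jA^{\oplus}=A^{\oplus}A^j$ for all integers $j\ge1$; (g) $A^jA^{\oplus}=A^{\oplus}A^j$ for some integer $j\ge1$; (h) $A^{\oplus}=A^d$; (i) $A^jA^{\dagger,\oplus}=A^{\dagger,\oplus}A^j$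 for all integers $j\ge1$; (j) $A^jA^{\dagger,\oplus}=A^{\dagger,\oplus}A^j$ for some integer $j\ge1$; (k) $A^{\dagger,\oplus}=A^d$; (l) $S=0$; (m) $\tilde T_k=0$; (n) $\tilde T_m=0$ (for the given, arbitrary, $m$); (o) $A^{\oplus}=A^d=A^{d,\dagger}=A^{\dagger,d}=A^{c,\dagger}=A^{w}=A^{\dagger,\oplus}=A^{w,\dagger}=A^{\dagger,w}$. -/

import Mathlib

open scoped Matrix

namespace GenInv

/-- `X` satisfies the four Penrose equations for `A`. -/
def IsMoorePenrose {m n : ℕ} (A : Matrix (Fin m) (Fin n) ℂ) (X : Matrix (Fin n) (Fin m) ℂ) :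
    Prop :=
  A * X * A = A ∧ X * A * X = X ∧ (A * X)ᴴ = A * X ∧ (X * A)ᴴ = X * A

theorem exists_isMoorePenrose {m n : ℕ} (A : Matrix (Fin m) (Fin n) ℂ) :
    ∃ X, IsMoorePenrose A X := by
  have hB : (Aᴴ * A).IsHermitian := Matrix.isHermitian_conjTranspose_mul_self A
  obtain ⟨V, V', D, hV, hV', hBV⟩ : ∃ (V V' : Matrix (Fin n) (Fin n) ℂ) (d : Fin n → ℝ),
      V' * V = 1 ∧ V' = Vᴴ ∧
        Aᴴ * A = V * Matrix.diagonal (fun i => (d i : ℂ)) * V' := by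
    refine ⟨hB.eigenvectorUnitary, star (hB.eigenvectorUnitary : Matrix (Fin n) (Fin n) ℂ),
      hB.eigenvalues, Unitary.coe_star_mul_self _, rfl, ?_⟩
    simpa [Unitary.conjStarAlgAut_apply, Function.comp_def] using hB.spectral_theorem
  set P : Matrix (Fin n) (Fin n) ℂ := V * Matrix.diagonal (fun i => ((D i)⁻¹ : ℂ)) * V' with hP
  have key : ∀ d e : Fin n → ℂ, V * Matrix.diagonal d * V' * (V * Matrix.diagonal e * V')
      = V * Matrix.diagonal (fun i => d i * e i) * V' := by
    intro d e
    calc _ = V * Matrix.diagonal d * (V' * V) * Matrix.diagonal e * V' := by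
            simp only [Matrix.mul_assoc]
      _ = _ := by rw [hV, Matrix.mul_one, Matrix.mul_assoc V, Matrix.diagonal_mul_diagonal]
  have herm : ∀ d : Fin n → ℝ, (V * Matrix.diagonal (fun i => (d i : ℂ)) * V')ᴴ
      = V * Matrix.diagonal (fun i => (d i : ℂ)) * V' := by
    intro d
    rw [hV', Matrix.conjTranspose_mul, Matrix.conjTranspose_mul, Matrix.conjTranspose_conjTranspose,
      Matrix.diagonal_conjTranspose, Matrix.mul_assoc]
    congr 3
    ext i
    simp
  have hPh : Pᴴ = P := by simpa [hP] using herm (fun i => (D i)⁻¹)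
  have hPBP : P * (Aᴴ * A) * P = P := by
    rw [hBV, hP, key, key]
    congr 3
    ext i
    by_cases h : (D i : ℂ) = 0 <;> simp [h]
  have hBPB : (Aᴴ * A) * P * (Aᴴ * A) = Aᴴ * A := by
    rw [hBV, hP, key, key]
    congr 3
    ext i
    by_cases h : (D i : ℂ) = 0 <;> simp [h]
  have hPBh : (P * (Aᴴ * A))ᴴ = P * (Aᴴ * A) := by
    rw [hBV, hP, key]
    simpa using herm (fun i => (D i)⁻¹ * D i)
  have hAPB : A * (P * (Aᴴ * A)) = A := by
    have h0 : A * (P * (Aᴴ * A)) - A = 0 := by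
      have hBz : (Aᴴ * A) * (P * (Aᴴ * A)) - Aᴴ * A = 0 := by
        rw [← Matrix.mul_assoc, hBPB, sub_self]
      have h1 : (A * (P * (Aᴴ * A)) - A)ᴴ * (A * (P * (Aᴴ * A)) - A) = 0 := by
        have h2 : Aᴴ * (A * (P * (Aᴴ * A)) - A) = 0 := by
          rw [Matrix.mul_sub, ← Matrix.mul_assoc Aᴴ A]
          exact hBz
        rw [Matrix.conjTranspose_sub, Matrix.conjTranspose_mul, Matrix.sub_mul, Matrix.mul_assoc,
          h2, Matrix.mul_zero, sub_zero]
      open scoped ComplexOrder in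
      exact Matrix.conjTranspose_mul_self_eq_zero.mp h1
    exact sub_eq_zero.mp h0
  refine ⟨P * Aᴴ, ?_, ?_, ?_, ?_⟩
  · simpa only [Matrix.mul_assoc] using hAPB
  · calc _ = P * (Aᴴ * A) * P * Aᴴ := by simp only [Matrix.mul_assoc]
      _ = _ := by rw [hPBP]
  · simp only [Matrix.conjTranspose_mul, Matrix.conjTranspose_conjTranspose, hPh, Matrix.mul_assoc]
  · simpa only [Matrix.mul_assoc] using hPBh

theorem IsMoorePenrose.unique {m n : ℕ} {A : Matrix (Fin m) (Fin n) ℂ}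
    {X Y : Matrix (Fin n) (Fin m) ℂ} (hX : IsMoorePenrose A X) (hY : IsMoorePenrose A Y) :
    X = Y := by
  obtain ⟨x1, x2, x3, x4⟩ := hX
  obtain ⟨y1, y2, y3, y4⟩ := hY
  have e1 : A * X = A * Y := by
    calc A * X = (A * Y * A) * X := by rw [y1]
      _ = (A * Y)ᴴ * (A * X)ᴴ := by rw [x3, y3, Matrix.mul_assoc]
      _ = (A * X * A * Y)ᴴ := by rw [← Matrix.conjTranspose_mul]; simp only [Matrix.mul_assoc]
      _ = A * Y := by rw [x1, y3]
  have e2 : X * A = Y * A := by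
    calc X * A = X * (A * Y * A) := by rw [y1]
      _ = (X * A)ᴴ * (Y * A)ᴴ := by rw [x4, y4]; simp only [Matrix.mul_assoc]
      _ = (Y * (A * X * A))ᴴ := by rw [← Matrix.conjTranspose_mul]; simp only [Matrix.mul_assoc]
      _ = Y * A := by rw [x1, y4]
  calc X = X * A * X := x2.symm
    _ = Y * (A * X) := by rw [e2, Matrix.mul_assoc]
    _ = Y := by rw [e1, ← Matrix.mul_assoc, y2]

/-- The Moore-Penrose inverse. -/
noncomputable def moorePenrose {m n : ℕ} (A : Matrix (Fin m) (Fin n) ℂ) :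
    Matrix (Fin n) (Fin m) ℂ :=
  Classical.choose (exists_isMoorePenrose A)

theorem moorePenrose_spec {m n : ℕ} (A : Matrix (Fin m) (Fin n) ℂ) :
    IsMoorePenrose A (moorePenrose A) :=
  Classical.choose_spec (exists_isMoorePenrose A)

/-- The orthogonal projector `A A†` onto the range of `A`. -/
noncomputable def projP {n : ℕ} (A : Matrix (Fin n) (Fin n) ℂ) : Matrix (Fin n) (Fin n) ℂ :=
  A * moorePenrose A

/-- The orthogonal projector `A† A` onto the range of `Aᴴ`. -/
noncomputable def projQ {n : ℕ} (A : Matrix (Fin n) (Fin n) ℂ) : Matrix (Fin n) (Fin n) ℂ :=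
  moorePenrose A * A

theorem exists_rank_pow_eq {n : ℕ} (A : Matrix (Fin n) (Fin n) ℂ) :
    ∃ k : ℕ, (A ^ k).rank = (A ^ (k + 1)).rank := by
  by_contra! h
  have hlt : ∀ k, (A ^ (k + 1)).rank < (A ^ k).rank := fun k =>
    lt_of_le_of_ne (by rw [pow_succ]; exact Matrix.rank_mul_le_left _ _) (h k).symm
  have hb : ∀ k, (A ^ k).rank + k ≤ (A ^ 0).rank := by
    intro k
    induction k with
    | zero => simp
    | succ k ih => have := hlt k; omega
  have := hb ((A ^ 0).rank + 1)
  omega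

open Classical in
/-- The index: the smallest `k ≥ 0` with `rank (A ^ k) = rank (A ^ (k + 1))`. -/
noncomputable def index {n : ℕ} (A : Matrix (Fin n) (Fin n) ℂ) : ℕ :=
  Nat.find (exists_rank_pow_eq A)

theorem index_spec {n : ℕ} (A : Matrix (Fin n) (Fin n) ℂ) :
    (A ^ index A).rank = (A ^ (index A + 1)).rank := by
  classical
  exact Nat.find_spec (exists_rank_pow_eq A)

/-- `X` satisfies the equations that define the Drazin inverse of `A`. -/
def IsDrazin {n : ℕ} (A X : Matrix (Fin n) (Fin n) ℂ) : Prop :=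
  X * A * X = X ∧ A * X = X * A ∧ X * A ^ (index A + 1) = A ^ index A

theorem IsDrazin.unique {n : ℕ} {A X Y : Matrix (Fin n) (Fin n) ℂ}
    (hX : IsDrazin A X) (hY : IsDrazin A Y) : X = Y := by
  obtain ⟨x1, x2, x3⟩ := hX
  obtain ⟨y1, y2, y3⟩ := hY
  have cX : Commute A X := x2
  have cY : Commute A Y := y2
  have pX : ∀ j : ℕ, X ^ (j + 1) * A ^ j = X := by
    intro j
    induction j with
    | zero => simp
    | succ j ih =>
      calc X ^ (j + 1 + 1) * A ^ (j + 1) = X * (X ^ (j + 1) * A ^ j) * A := by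
            rw [pow_succ' X (j + 1), pow_succ A j]; simp only [mul_assoc]
        _ = X * A * X := by rw [ih, mul_assoc, mul_assoc, x2]
        _ = X := x1
  have pY : ∀ j : ℕ, A ^ j * Y ^ (j + 1) = Y := by
    intro j
    induction j with
    | zero => simp
    | succ j ih =>
      calc A ^ (j + 1) * Y ^ (j + 1 + 1) = A * (A ^ j * Y ^ (j + 1)) * Y := by
            rw [pow_succ' A j, pow_succ Y (j + 1)]; simp only [mul_assoc]
        _ = Y * A * Y := by rw [ih, y2]
        _ = Y := y1
  have hXY : X = X * (A * Y) := by
    calc X = X ^ (index A + 1) * A ^ index A := (pX _).symm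
      _ = X ^ (index A + 1) * (A ^ (index A + 1) * Y) := by
          rw [(cY.pow_left _).eq, y3]
      _ = X ^ (index A + 1) * A ^ index A * (A * Y) := by
          rw [pow_succ A]; simp only [mul_assoc]
      _ = X * (A * Y) := by rw [pX]
  have hYX : Y = X * (A * Y) := by
    calc Y = A ^ index A * Y ^ (index A + 1) := (pY _).symm
      _ = X * A ^ (index A + 1) * Y ^ (index A + 1) := by rw [x3]
      _ = X * A * (A ^ index A * Y ^ (index A + 1)) := by
          rw [pow_succ' A]; simp only [mul_assoc]
      _ = X * (A * Y) := by rw [pY, mul_assoc]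
  exact hXY.trans hYX.symm

theorem exists_isDrazin {n : ℕ} (A : Matrix (Fin n) (Fin n) ℂ) : ∃ X, IsDrazin A X := by
  set k := index A with hk
  have hker : LinearMap.ker (A ^ k).mulVecLin = LinearMap.ker (A ^ (k + 1)).mulVecLin := by
    apply Submodule.eq_of_le_of_finrank_eq
    · intro v hv
      simp only [LinearMap.mem_ker, Matrix.mulVecLin_apply] at hv ⊢
      rw [pow_succ', ← Matrix.mulVec_mulVec, hv, Matrix.mulVec_zero]
    · have h1 := (A ^ k).mulVecLin.finrank_range_add_finrank_ker
      have h2 := (A ^ (k + 1)).mulVecLin.finrank_range_add_finrank_ker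
      have h3 : Module.finrank ℂ (LinearMap.range (A ^ k).mulVecLin)
          = Module.finrank ℂ (LinearMap.range (A ^ (k + 1)).mulVecLin) := index_spec A
      omega
  have hinj : ∀ j : ℕ, ∀ v : Fin n → ℂ, (A ^ (k + j)) *ᵥ v = 0 → (A ^ k) *ᵥ v = 0 := by
    intro j
    induction j with
    | zero => intro v hv; simpa using hv
    | succ j ih =>
      intro v hv
      apply ih
      have h1 : A ^ j *ᵥ v ∈ LinearMap.ker (A ^ (k + 1)).mulVecLin := by
        rw [LinearMap.mem_ker, Matrix.mulVecLin_apply, Matrix.mulVec_mulVec, ← pow_add]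
        rwa [show k + 1 + j = k + (j + 1) by omega]
      rw [← hker, LinearMap.mem_ker, Matrix.mulVecLin_apply, Matrix.mulVec_mulVec, ← pow_add] at h1
      exact h1
  have hcancel : ∀ M : Matrix (Fin n) (Fin n) ℂ, A ^ (k + (k + 1)) * M = 0 → A ^ k * M = 0 := by
    intro M hM
    ext i j
    have h1 : A ^ (k + (k + 1)) *ᵥ (fun i => M i j) = 0 := by
      ext i'
      exact congrFun (congrFun hM i') j
    exact congrFun (hinj _ _ h1) i
  set G := moorePenrose (A ^ (k + (k + 1))) with hG
  have hg : A ^ (k + (k + 1)) * G * A ^ (k + (k + 1)) = A ^ (k + (k + 1)) :=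
    (moorePenrose_spec _).1
  have hR : A ^ k * G * A ^ (k + (k + 1)) = A ^ k := by
    have h1 : A ^ (k + (k + 1)) * (G * A ^ (k + (k + 1)) - 1) = 0 := by
      rw [mul_sub, mul_one, ← mul_assoc, hg, sub_self]
    have h2 := hcancel _ h1
    rw [mul_sub, mul_one, sub_eq_zero, ← mul_assoc] at h2
    exact h2
  have hrk : ∀ j : ℕ, LinearMap.range (A ^ (k + j)).mulVecLin = LinearMap.range (A ^ k).mulVecLin := by
    intro j
    apply Submodule.eq_of_le_of_finrank_eq
    · rintro _ ⟨v, rfl⟩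
      refine ⟨A ^ j *ᵥ v, ?_⟩
      simp only [Matrix.mulVecLin_apply]
      rw [Matrix.mulVec_mulVec, ← pow_add]
    · have h1 := (A ^ k).mulVecLin.finrank_range_add_finrank_ker
      have h2 := (A ^ (k + j)).mulVecLin.finrank_range_add_finrank_ker
      have h3 : LinearMap.ker (A ^ (k + j)).mulVecLin = LinearMap.ker (A ^ k).mulVecLin := by
        apply le_antisymm
        · intro v hv
          exact hinj j v hv
        · intro v hv
          simp only [LinearMap.mem_ker, Matrix.mulVecLin_apply] at hv ⊢
          rw [add_comm, pow_add, ← Matrix.mulVec_mulVec, hv, Matrix.mulVec_zero]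
      rw [h3] at h2
      omega
  have hL : A ^ (k + (k + 1)) * G * A ^ k = A ^ k := by
    apply Matrix.toLin'.injective
    ext1 i
    ext1
    have hmem : A ^ k *ᵥ (Pi.single i 1) ∈ LinearMap.range (A ^ (k + (k + 1))).mulVecLin := by
      rw [hrk]
      exact ⟨_, rfl⟩
    obtain ⟨w, hw⟩ := hmem
    simp only [Matrix.mulVecLin_apply] at hw
    simp only [LinearMap.comp_apply, Matrix.toLin'_apply, LinearMap.single_apply]
    rw [← Matrix.mulVec_mulVec, ← hw, Matrix.mulVec_mulVec, hg]
  have hAX : A * (A ^ k * G * A ^ k) = (A ^ k * G * A ^ k) * A := by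
    have h1 : A ^ k * (A * (A ^ k * G * A ^ k)) = A ^ k := by
      rw [show A ^ k * (A * (A ^ k * G * A ^ k)) = A ^ (k + (k + 1)) * G * A ^ k by
        rw [pow_add, pow_succ']; simp only [mul_assoc], hL]
    have h2 : (A ^ k * G * A ^ k) * A * A ^ k = A ^ k := by
      rw [show (A ^ k * G * A ^ k) * A * A ^ k = A ^ k * G * A ^ (k + (k + 1)) by
        rw [pow_add, pow_succ']; simp only [mul_assoc], hR]
    calc A * (A ^ k * G * A ^ k) = (A * A ^ k) * G * A ^ k := by simp only [mul_assoc]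
      _ = ((A ^ k * G * A ^ k) * A * A ^ k) * A * G * A ^ k := by
          rw [h2, ← pow_succ', ← pow_succ]
      _ = A ^ k * G * ((A ^ k * A) * (A ^ k * A) * G * A ^ k) := by
          simp only [mul_assoc]
      _ = A ^ k * G * (A * (A ^ (k + (k + 1)) * G * A ^ k)) := by
          rw [← pow_succ, ← pow_add, show k + 1 + (k + 1) = k + (k + 1) + 1 by
            omega, pow_succ' A (k + (k + 1))]
          simp only [mul_assoc]
      _ = (A ^ k * G * A ^ k) * A := by
          rw [hL, ← pow_succ', pow_succ]; simp only [mul_assoc]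
  refine ⟨A ^ k * G * A ^ k, ?_, hAX, ?_⟩
  · calc (A ^ k * G * A ^ k) * A * (A ^ k * G * A ^ k)
        = A ^ k * G * (A ^ (k + (k + 1)) * G * A ^ k) := by
          rw [pow_add, pow_succ']; simp only [mul_assoc]
      _ = _ := by rw [hL]
  · calc (A ^ k * G * A ^ k) * A ^ (k + 1) = A ^ k * G * A ^ (k + (k + 1)) := by
          rw [pow_add A k (k + 1)]; simp only [mul_assoc]
      _ = _ := hR

/-- The Drazin inverse `A^d`. -/
noncomputable def drazin {n : ℕ} (A : Matrix (Fin n) (Fin n) ℂ) : Matrix (Fin n) (Fin n) ℂ :=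
  Classical.choose (exists_isDrazin A)

theorem drazin_spec {n : ℕ} (A : Matrix (Fin n) (Fin n) ℂ) : IsDrazin A (drazin A) :=
  Classical.choose_spec (exists_isDrazin A)

/-- The core EP inverse `A^k (A^(k+1))†`, where `k` is the index of `A`. -/
noncomputable def coreEP {n : ℕ} (A : Matrix (Fin n) (Fin n) ℂ) : Matrix (Fin n) (Fin n) ℂ :=
  A ^ index A * moorePenrose (A ^ (index A + 1))

/-- The DMP inverse `A^d P_A`. -/
noncomputable def dmp {n : ℕ} (A : Matrix (Fin n) (Fin n) ℂ) : Matrix (Fin n) (Fin n) ℂ :=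
  drazin A * projP A

/-- The dual DMP inverse `Q_A A^d`. -/
noncomputable def dualDMP {n : ℕ} (A : Matrix (Fin n) (Fin n) ℂ) : Matrix (Fin n) (Fin n) ℂ :=
  projQ A * drazin A

/-- The CMP inverse `Q_A A^d P_A`. -/
noncomputable def cmp {n : ℕ} (A : Matrix (Fin n) (Fin n) ℂ) : Matrix (Fin n) (Fin n) ℂ :=
  projQ A * dmp A

/-- The weak group (WG) inverse: the square of the core EP inverse, times `A`. -/
noncomputable def weakGroup {n : ℕ} (A : Matrix (Fin n) (Fin n) ℂ) : Matrix (Fin n) (Fin n) ℂ :=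
  coreEP A ^ 2 * A

/-- The MPCEP inverse: `Q_A` times the core EP inverse. -/
noncomputable def mpcep {n : ℕ} (A : Matrix (Fin n) (Fin n) ℂ) : Matrix (Fin n) (Fin n) ℂ :=
  projQ A * coreEP A

/-- The weak core (WC) inverse: the WG inverse times `P_A`. -/
noncomputable def weakCore {n : ℕ} (A : Matrix (Fin n) (Fin n) ℂ) : Matrix (Fin n) (Fin n) ℂ :=
  weakGroup A * projP A

/-- The dual weak core inverse: `Q_A` times the WG inverse. -/
noncomputable def dualWeakCore {n : ℕ} (A : Matrix (Fin n) (Fin n) ℂ) :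
    Matrix (Fin n) (Fin n) ℂ :=
  projQ A * weakGroup A

/-- `k`-index EP matrices: index `k`, and `A^k` commutes with `(A^k)†`. -/
def kIndexEPClass (n k : ℕ) : Set (Matrix (Fin n) (Fin n) ℂ) :=
  {A | index A = k ∧ A ^ k * moorePenrose (A ^ k) = moorePenrose (A ^ k) * A ^ k}

/-- `k`-core EP matrices. -/
def kCoreEPClass (n k : ℕ) : Set (Matrix (Fin n) (Fin n) ℂ) :=
  {A | index A = k ∧ A ^ k * coreEP A = coreEP A * A ^ k}

/-- `{m,k}`-core EP matrices. -/
def mkCoreEPClass (n m k : ℕ) : Set (Matrix (Fin n) (Fin n) ℂ) :=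
  {A | index A = k ∧ A ^ m * coreEP A = coreEP A * A ^ m}

/-- `k`-MPCEP matrices. -/
def kMPCEPClass (n k : ℕ) : Set (Matrix (Fin n) (Fin n) ℂ) :=
  {A | index A = k ∧ A ^ k * mpcep A = mpcep A * A ^ k}

/-- `k`-WC matrices. -/
def kWCClass (n k : ℕ) : Set (Matrix (Fin n) (Fin n) ℂ) :=
  {A | index A = k ∧ A ^ k * weakCore A = weakCore A * A ^ k}

/-- Dual `k`-WC matrices. -/
def dualKWCClass (n k : ℕ) : Set (Matrix (Fin n) (Fin n) ℂ) :=
  {A | index A = k ∧ A ^ k * dualWeakCore A = dualWeakCore A * A ^ k}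

/-- The `n × n` matrix, `n = t + s`, with the four given blocks in the usual order. -/
def blockMatrix {n t s : ℕ} (hts : t + s = n) (T : Matrix (Fin t) (Fin t) ℂ)
    (S : Matrix (Fin t) (Fin s) ℂ) (R : Matrix (Fin s) (Fin t) ℂ) (N : Matrix (Fin s) (Fin s) ℂ) :
    Matrix (Fin n) (Fin n) ℂ :=
  Matrix.reindex (finSumFinEquiv.trans (finCongr hts)) (finSumFinEquiv.trans (finCongr hts))
    (Matrix.fromBlocks T S R N)

/-- `A = U [T S; 0 N] Uᴴ` is a core EP decomposition of `A`: `U` is unitary, `T` is nonsingular of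
size `t = rank (A^k)`, and `N` is nilpotent of index `k`, where `k` is the index of `A`. -/
structure IsCoreEPDecomposition {n t s : ℕ} (A : Matrix (Fin n) (Fin n) ℂ) (hts : t + s = n)
    (U : Matrix (Fin n) (Fin n) ℂ) (T : Matrix (Fin t) (Fin t) ℂ)
    (S : Matrix (Fin t) (Fin s) ℂ) (N : Matrix (Fin s) (Fin s) ℂ) : Prop where
  unitary : U ∈ Matrix.unitaryGroup (Fin n) ℂ
  nonsingular : IsUnit T.det
  size : t = (A ^ index A).rank
  nilpotent : IsNilpotent N
  nilpotent_index : nilpotencyClass N = index A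
  eq : A = U * blockMatrix hts T S 0 N * Uᴴ

/-- `T̃_m = ∑_{i=0}^{m-1} T^i S N^(m-1-i)`. -/
def tTilde {t s : ℕ} (T : Matrix (Fin t) (Fin t) ℂ) (S : Matrix (Fin t) (Fin s) ℂ)
    (N : Matrix (Fin s) (Fin s) ℂ) (m : ℕ) : Matrix (Fin t) (Fin s) ℂ :=
  ∑ i ∈ Finset.range m, T ^ i * S * N ^ (m - 1 - i)

end GenInv

/-! All conditions reduce to `S = 0`. In the splitting given by `U`, the power `A ^ j` is block
upper triangular with corner T̃_j, and the core EP inverse X is T⁻¹ in the leading block and zero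
elsewhere (`coreEP_eq`). Hence A^j commutes with X exactly when T̃_j = 0, and for every j ≥ 1 this
means S = 0, because T is invertible and N nilpotent (`tTilde_eq_zero_iff`).

The other inverses carry factors Q_A or P_A. Since A Q_A = A, multiplying a commutation relation by
A on the left removes Q_A; this settles the MPCEP conditions. The two weak core conditions are used
together: the dual one gives SN = 0, and then the other gives S = 0 (`eq_zero_of_weakCore_comm`).

Conversely, if S = 0, then X commutes with A, so it is the Drazin inverse; as AX is Hermitian, X
absorbs both Q_A and P_A, and all the inverses coincide (`inverses_eq_coreEP`). -/

namespace GenInv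

/-! ### The sums T̃_j: recursions and vanishing. -/

section TTilde

variable {t s : ℕ} (T : Matrix (Fin t) (Fin t) ℂ) (S : Matrix (Fin t) (Fin s) ℂ)
  (N : Matrix (Fin s) (Fin s) ℂ)

theorem tTilde_succ (j : ℕ) : tTilde T S N (j + 1) = T * tTilde T S N j + S * N ^ j := by
  unfold tTilde
  rw [Finset.sum_range_succ', Matrix.mul_sum]
  congr 1
  · refine Finset.sum_congr rfl fun i _ => ?_
    rw [pow_succ', show j + 1 - 1 - (i + 1) = j - 1 - i by omega]
    simp only [Matrix.mul_assoc]
  · simp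

theorem tTilde_succ' (j : ℕ) : tTilde T S N (j + 1) = T ^ j * S + tTilde T S N j * N := by
  unfold tTilde
  rw [Finset.sum_range_succ, Matrix.sum_mul, add_comm]
  congr 1
  · simp
  · refine Finset.sum_congr rfl fun i hi => ?_
    have hi' := Finset.mem_range.mp hi
    -- This truncated subtraction needs i < j.
    rw [show j + 1 - 1 - i = (j - 1 - i) + 1 by omega, pow_succ]
    simp only [Matrix.mul_assoc]

theorem tTilde_zero_right (j : ℕ) : tTilde T (0 : Matrix (Fin t) (Fin s) ℂ) N j = 0 := by
  simp [tTilde]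

/-- Makes T̃_j N itself a sum of the same kind, so that its vanishing forces SN = 0. -/
theorem tTilde_mul_right (j : ℕ) : tTilde T (S * N) N j = tTilde T S N j * N := by
  unfold tTilde
  rw [Matrix.sum_mul]
  refine Finset.sum_congr rfl fun i _ => ?_
  simp only [Matrix.mul_assoc, ← pow_succ, ← pow_succ']

variable {T S N}

theorem eq_zero_of_isUnit_mul {B : Matrix (Fin t) (Fin t) ℂ} (hB : IsUnit B)
    {C : Matrix (Fin t) (Fin s) ℂ} (h : B * C = 0) : C = 0 := by
  obtain ⟨u, rfl⟩ := hB
  calc C = (↑u⁻¹ * (u : Matrix (Fin t) (Fin t) ℂ)) * C := by rw [Units.inv_mul, Matrix.one_mul]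
    _ = 0 := by rw [Matrix.mul_assoc, h, Matrix.mul_zero]

/-- Peeling T̃_(j+1) from the left and from the right shows that T̃_j = 0 gives T^j S = S N^j.
Iterating r times gives T^(jr) S = S N^(jr), which is zero once N^r = 0 because j ≥ 1. -/
theorem tTilde_eq_zero_iff (hT : IsUnit T) (hN : IsNilpotent N) {j : ℕ} (hj : 1 ≤ j) :
    tTilde T S N j = 0 ↔ S = 0 := by
  refine ⟨fun h => ?_, fun h => by rw [h, tTilde_zero_right]⟩
  have h1 : T ^ j * S = S * N ^ j := by
    have h2 := tTilde_succ T S N j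
    rw [tTilde_succ', h] at h2
    simpa using h2
  have h2 : ∀ i : ℕ, (T ^ j) ^ i * S = S * (N ^ j) ^ i := by
    intro i
    induction i with
    | zero => simp
    | succ i ih =>
      rw [pow_succ, Matrix.mul_assoc, h1, ← Matrix.mul_assoc, ih, Matrix.mul_assoc, ← pow_succ]
  obtain ⟨r, hr⟩ := hN
  have h3 := h2 r
  rw [← pow_mul N, mul_comm j r, pow_mul N, hr, zero_pow (by omega), Matrix.mul_zero] at h3
  exact eq_zero_of_isUnit_mul ((hT.pow j).pow r) h3

end TTilde

/-! ### Block calculus in a unitary splitting. -/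

/-- The matrix whose blocks with respect to the splitting `U` of the space are the given ones. -/
def conjBlock {n t s : ℕ} (U : Matrix (Fin n) (Fin n) ℂ) (hts : t + s = n)
    (B : Matrix (Fin t) (Fin t) ℂ) (C : Matrix (Fin t) (Fin s) ℂ) (D : Matrix (Fin s) (Fin t) ℂ)
    (E : Matrix (Fin s) (Fin s) ℂ) : Matrix (Fin n) (Fin n) ℂ :=
  U * blockMatrix hts B C D E * Uᴴ

section ConjBlock

variable {n t s : ℕ} {U : Matrix (Fin n) (Fin n) ℂ} {hts : t + s = n}
  {B B' : Matrix (Fin t) (Fin t) ℂ} {C C' : Matrix (Fin t) (Fin s) ℂ}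
  {D D' : Matrix (Fin s) (Fin t) ℂ} {E E' : Matrix (Fin s) (Fin s) ℂ}

theorem conjBlock_mul (hU : U ∈ Matrix.unitaryGroup (Fin n) ℂ) :
    conjBlock U hts B C D E * conjBlock U hts B' C' D' E' =
      conjBlock U hts (B * B' + C * D') (B * C' + C * E') (D * B' + E * D') (D * C' + E * E') := by
  have hU' : Uᴴ * U = 1 := Matrix.mem_unitaryGroup_iff'.mp hU
  unfold conjBlock blockMatrix
  rw [← Matrix.fromBlocks_multiply]
  simp only [Matrix.reindex_apply]
  rw [← Matrix.submatrix_mul_equiv _ _ _ (finSumFinEquiv.trans (finCongr hts)).symm _]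
  calc _ = U * _ * (Uᴴ * U) * _ * Uᴴ := by simp only [Matrix.mul_assoc]; rfl
    _ = _ := by rw [hU', Matrix.mul_one]; simp only [Matrix.mul_assoc]

theorem conjBlock_conjTranspose :
    (conjBlock U hts B C D E)ᴴ = conjBlock U hts Bᴴ Dᴴ Cᴴ Eᴴ := by
  unfold conjBlock blockMatrix
  simp only [Matrix.conjTranspose_mul, Matrix.conjTranspose_conjTranspose,
    Matrix.conjTranspose_reindex, Matrix.fromBlocks_conjTranspose, Matrix.mul_assoc]

theorem conjBlock_one (hU : U ∈ Matrix.unitaryGroup (Fin n) ℂ) :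
    conjBlock U hts 1 0 0 1 = 1 := by
  have hU' : U * Uᴴ = 1 := Matrix.mem_unitaryGroup_iff.mp hU
  unfold conjBlock blockMatrix
  rw [Matrix.fromBlocks_one, Matrix.reindex_apply, Matrix.submatrix_one_equiv, Matrix.mul_one, hU']

theorem conjBlock_inj (hU : U ∈ Matrix.unitaryGroup (Fin n) ℂ) :
    conjBlock U hts B C D E = conjBlock U hts B' C' D' E' ↔ B = B' ∧ C = C' ∧ D = D' ∧ E = E' := by
  have hU' : Uᴴ * U = 1 := Matrix.mem_unitaryGroup_iff'.mp hU
  refine ⟨fun h => ?_, by rintro ⟨rfl, rfl, rfl, rfl⟩; rfl⟩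
  have cancel : ∀ M : Matrix (Fin n) (Fin n) ℂ, Uᴴ * (U * M * Uᴴ) * U = M := fun M => by
    calc _ = (Uᴴ * U) * M * (Uᴴ * U) := by simp only [Matrix.mul_assoc]
      _ = M := by rw [hU', Matrix.one_mul, Matrix.mul_one]
  have h1 := congrArg (fun M => Uᴴ * M * U) h
  simp only [conjBlock, cancel] at h1
  exact Matrix.fromBlocks_inj.mp ((Matrix.reindex _ _).injective h1)

variable (hts) in
theorem exists_eq_conjBlock (hU : U ∈ Matrix.unitaryGroup (Fin n) ℂ)
    (M : Matrix (Fin n) (Fin n) ℂ) :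
    ∃ (B : Matrix (Fin t) (Fin t) ℂ) (C : Matrix (Fin t) (Fin s) ℂ)
      (D : Matrix (Fin s) (Fin t) ℂ) (E : Matrix (Fin s) (Fin s) ℂ), M = conjBlock U hts B C D E := by
  have hU' : U * Uᴴ = 1 := Matrix.mem_unitaryGroup_iff.mp hU
  set e := finSumFinEquiv.trans (finCongr hts)
  set M' := (Matrix.reindex e e).symm (Uᴴ * M * U) with hM'
  refine ⟨M'.toBlocks₁₁, M'.toBlocks₁₂, M'.toBlocks₂₁, M'.toBlocks₂₂, ?_⟩
  unfold conjBlock blockMatrix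
  rw [Matrix.fromBlocks_toBlocks, hM', Equiv.apply_symm_apply]
  calc M = (U * Uᴴ) * M * (U * Uᴴ) := by rw [hU', Matrix.one_mul, Matrix.mul_one]
    _ = _ := by simp only [Matrix.mul_assoc]

theorem conjBlock_upper_pow (hU : U ∈ Matrix.unitaryGroup (Fin n) ℂ) (j : ℕ) :
    conjBlock U hts B C 0 E ^ j = conjBlock U hts (B ^ j) (tTilde B C E j) 0 (E ^ j) := by
  induction j with
  | zero => simp [tTilde, conjBlock_one hU]
  | succ j ih =>
    rw [pow_succ, ih, conjBlock_mul hU, tTilde_succ']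
    simp [pow_succ]

/-- The range projector of a block upper triangular matrix with invertible leading block. -/
theorem exists_projP_conjBlock (hU : U ∈ Matrix.unitaryGroup (Fin n) ℂ) (hB : IsUnit B) :
    ∃ G, projP (conjBlock U hts B C 0 E) = conjBlock U hts 1 0 0 (E * G) := by
  obtain ⟨h1, -, h3, -⟩ := moorePenrose_spec (conjBlock U hts B C 0 E)
  obtain ⟨a, b, c, d, hG⟩ := exists_eq_conjBlock hts hU (moorePenrose (conjBlock U hts B C 0 E))
  refine ⟨d, ?_⟩
  unfold projP
  rw [hG] at h1 h3 ⊢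
  rw [conjBlock_mul hU] at h1 h3 ⊢
  rw [conjBlock_mul hU, conjBlock_inj hU] at h1
  rw [conjBlock_conjTranspose, conjBlock_inj hU] at h3
  simp only [Matrix.zero_mul, Matrix.mul_zero, zero_add, add_zero] at h1 h3 ⊢
  obtain ⟨e1, -, e3, -⟩ := h1
  obtain ⟨-, f2, -, -⟩ := h3
  -- The first column of blocks in AGA = A fixes the first column of AG as (1, 0); Hermitian
  -- symmetry then clears the upper right corner.
  have g1 : B * a + C * c = 1 := hB.mul_right_cancel (by rw [e1, one_mul])
  have g3 : E * c = 0 := by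
    obtain ⟨u, rfl⟩ := hB
    calc E * c = E * c * (↑u * (↑u⁻¹ : Matrix (Fin t) (Fin t) ℂ)) := by
          rw [Units.mul_inv, Matrix.mul_one]
      _ = 0 := by rw [← Matrix.mul_assoc, e3, Matrix.zero_mul]
  rw [g3, Matrix.conjTranspose_zero] at f2
  rw [g1, g3, ← f2]

end ConjBlock

/-! ### Absorption of the projectors P_A and Q_A. -/

theorem mul_projQ {n : ℕ} (A : Matrix (Fin n) (Fin n) ℂ) : A * projQ A = A := by
  rw [projQ, ← mul_assoc]; exact (moorePenrose_spec A).1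

theorem projP_mul {n : ℕ} (A : Matrix (Fin n) (Fin n) ℂ) : projP A * A = A :=
  (moorePenrose_spec A).1

section Commuting

variable {n : ℕ} {A X : Matrix (Fin n) (Fin n) ℂ}

/-- AX = XA is unchanged by Q_A on its right; taking adjoints moves Q_A to the left, and X = (AX)X
carries this over to X. -/
theorem projQ_mul_of_commute (hX : A * X * X = X) (hc : A * X = X * A) (hh : (A * X)ᴴ = A * X) :
    projQ A * X = X := by
  have h4 : (projQ A)ᴴ = projQ A := (moorePenrose_spec A).2.2.2
  have h : projQ A * (A * X) = A * X := by
    calc projQ A * (A * X) = (X * A * projQ A)ᴴ := by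
          rw [Matrix.conjTranspose_mul, h4, ← hc, hh]
      _ = A * X := by rw [mul_assoc, mul_projQ, ← hc, hh]
  calc projQ A * X = projQ A * (A * X) * X := by rw [mul_assoc, hX]
    _ = X := by rw [h, hX]

theorem mul_projP_of_commute (hX : A * X * X = X) (hc : A * X = X * A) (hh : (A * X)ᴴ = A * X) :
    X * projP A = X := by
  have h3 : (projP A)ᴴ = projP A := (moorePenrose_spec A).2.2.1
  have h : A * X * projP A = A * X := by
    calc A * X * projP A = (projP A * (A * X))ᴴ := by
          rw [Matrix.conjTranspose_mul, h3, hh]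
      _ = A * X := by rw [← mul_assoc, projP_mul, hh]
  have hX' : X * (A * X) = X := by rw [← mul_assoc, ← hc, hX]
  calc X * projP A = X * (A * X * projP A) := by rw [← mul_assoc X, hX']
    _ = X := by rw [h, hX']

end Commuting

/-! ### Generalized inverses in a core EP decomposition. -/

namespace IsCoreEPDecomposition

variable {n t s : ℕ} {A : Matrix (Fin n) (Fin n) ℂ} {hts : t + s = n}
  {U : Matrix (Fin n) (Fin n) ℂ} {T : Matrix (Fin t) (Fin t) ℂ} {S : Matrix (Fin t) (Fin s) ℂ}
  {N : Matrix (Fin s) (Fin s) ℂ}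

theorem isUnit (h : IsCoreEPDecomposition A hts U T S N) : IsUnit T :=
  (Matrix.isUnit_iff_isUnit_det T).mpr h.nonsingular

theorem mul_inv (h : IsCoreEPDecomposition A hts U T S N) : T * T⁻¹ = 1 :=
  Matrix.mul_nonsing_inv T h.nonsingular

theorem inv_mul (h : IsCoreEPDecomposition A hts U T S N) : T⁻¹ * T = 1 :=
  Matrix.nonsing_inv_mul T h.nonsingular

theorem eq_conjBlock (h : IsCoreEPDecomposition A hts U T S N) :
    A = conjBlock U hts T S 0 N := h.eq

theorem pow_eq (h : IsCoreEPDecomposition A hts U T S N) (j : ℕ) :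
    A ^ j = conjBlock U hts (T ^ j) (tTilde T S N j) 0 (N ^ j) := by
  conv_lhs => rw [h.eq_conjBlock]
  exact conjBlock_upper_pow h.unitary j

theorem pow_index_eq_zero (h : IsCoreEPDecomposition A hts U T S N) : N ^ index A = 0 := by
  rw [← h.nilpotent_index]; exact pow_nilpotencyClass h.nilpotent

theorem projP_pow_index (h : IsCoreEPDecomposition A hts U T S N) (i : ℕ) :
    projP (A ^ (index A + i)) = conjBlock U hts 1 0 0 0 := by
  rw [h.pow_eq, pow_add N, h.pow_index_eq_zero, zero_mul]
  obtain ⟨G, hG⟩ := exists_projP_conjBlock (hts := hts) (C := tTilde T S N (index A + i)) (E := 0)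
    h.unitary (h.isUnit.pow (index A + i))
  rw [hG, zero_mul]

/-- Writing A^k = X A^(k+1), with X the claimed value, turns the definition into X times the range
projector of A^(k+1), so no Moore-Penrose inverse need be computed. -/
theorem coreEP_eq (h : IsCoreEPDecomposition A hts U T S N) :
    coreEP A = conjBlock U hts T⁻¹ 0 0 0 := by
  have h1 : A ^ index A = conjBlock U hts T⁻¹ 0 0 0 * A ^ (index A + 1) := by
    rw [h.pow_eq, h.pow_eq, conjBlock_mul h.unitary, conjBlock_inj h.unitary, tTilde_succ,
      pow_succ' T, h.pow_index_eq_zero]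
    simp [← Matrix.mul_assoc, h.inv_mul]
  unfold coreEP
  rw [h1, mul_assoc]
  change _ * projP (A ^ (index A + 1)) = _
  rw [h.projP_pow_index, conjBlock_mul h.unitary]
  simp

theorem mul_coreEP (h : IsCoreEPDecomposition A hts U T S N) :
    A * coreEP A = conjBlock U hts 1 0 0 0 := by
  rw [h.coreEP_eq]
  conv_lhs => rw [h.eq_conjBlock]
  rw [conjBlock_mul h.unitary]
  simp [h.mul_inv]

theorem mul_coreEP_mul_coreEP (h : IsCoreEPDecomposition A hts U T S N) :
    A * coreEP A * coreEP A = coreEP A := by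
  rw [h.mul_coreEP, h.coreEP_eq, conjBlock_mul h.unitary]
  simp

theorem mul_coreEP_isHermitian (h : IsCoreEPDecomposition A hts U T S N) :
    (A * coreEP A)ᴴ = A * coreEP A := by
  rw [h.mul_coreEP, conjBlock_conjTranspose]
  simp

theorem pow_mul_coreEP_comm_iff (h : IsCoreEPDecomposition A hts U T S N) {j : ℕ} (hj : 1 ≤ j) :
    A ^ j * coreEP A = coreEP A * A ^ j ↔ S = 0 := by
  obtain ⟨j, rfl⟩ := Nat.exists_eq_add_of_le' hj
  rw [← tTilde_eq_zero_iff h.isUnit h.nilpotent hj, h.coreEP_eq, h.pow_eq,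
    conjBlock_mul h.unitary, conjBlock_mul h.unitary, conjBlock_inj h.unitary]
  simp only [Matrix.zero_mul, Matrix.mul_zero, add_zero, and_true]
  constructor
  · rintro ⟨-, h2⟩
    calc tTilde T S N (j + 1) = T * T⁻¹ * tTilde T S N (j + 1) := by
          rw [h.mul_inv, Matrix.one_mul]
      _ = 0 := by rw [Matrix.mul_assoc, ← h2, Matrix.mul_zero]
  · intro h2
    refine ⟨?_, by rw [h2, Matrix.mul_zero]⟩
    rw [pow_succ, mul_assoc, h.mul_inv, ← pow_succ, pow_succ', ← mul_assoc, h.inv_mul]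
    simp

/-- The form that MPCEP commutation takes after left multiplication by A. The upper right corners of
the two sides are 0 and T̃_j. -/
theorem eq_zero_of_pow_succ_mul_coreEP (h : IsCoreEPDecomposition A hts U T S N) {j : ℕ}
    (hj : 1 ≤ j) (hc : A ^ (j + 1) * coreEP A = A * coreEP A * A ^ j) : S = 0 := by
  rw [← tTilde_eq_zero_iff h.isUnit h.nilpotent hj]
  rw [h.mul_coreEP, h.coreEP_eq, h.pow_eq, h.pow_eq, conjBlock_mul h.unitary,
    conjBlock_mul h.unitary, conjBlock_inj h.unitary] at hc
  simpa using hc.2.1.symm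

theorem eq_zero_of_pow_mul_mpcep (h : IsCoreEPDecomposition A hts U T S N) {j : ℕ}
    (hj : 1 ≤ j) (hc : A ^ j * mpcep A = mpcep A * A ^ j) : S = 0 := by
  refine h.eq_zero_of_pow_succ_mul_coreEP hj ?_
  have h1 : A ^ j * mpcep A = A ^ j * coreEP A := by
    obtain ⟨j, rfl⟩ := Nat.exists_eq_add_of_le' hj
    rw [mpcep, ← mul_assoc, pow_succ, mul_assoc (A ^ j), mul_projQ]
  calc A ^ (j + 1) * coreEP A = A * (A ^ j * mpcep A) := by rw [h1, pow_succ', mul_assoc]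
    _ = A * projQ A * coreEP A * A ^ j := by rw [hc, mpcep]; simp only [mul_assoc]
    _ = _ := by rw [mul_projQ]

theorem pow_index_isEP_iff (h : IsCoreEPDecomposition A hts U T S N) (hk : 1 ≤ index A) :
    A ^ index A * moorePenrose (A ^ index A) = moorePenrose (A ^ index A) * A ^ index A ↔
      S = 0 := by
  have hN := h.pow_index_eq_zero
  constructor
  · intro hc
    have hp : A ^ index A * moorePenrose (A ^ index A) = conjBlock U hts 1 0 0 0 :=
      h.projP_pow_index 0
    -- Commutation lets the range projector act as the identity on the right of A^k, which kills the
    -- corner T̃_k.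
    have h1 : A ^ index A * conjBlock U hts 1 0 0 0 = A ^ index A := by
      rw [← hp, hc, ← mul_assoc]; exact (moorePenrose_spec _).1
    rw [h.pow_eq, conjBlock_mul h.unitary, conjBlock_inj h.unitary] at h1
    rw [← tTilde_eq_zero_iff h.isUnit h.nilpotent hk]
    simpa using h1.2.1.symm
  · rintro rfl
    have hA : A ^ index A = conjBlock U hts (T ^ index A) 0 0 0 := by
      rw [h.pow_eq, tTilde_zero_right, hN]
    have hu : IsUnit (T ^ index A).det :=
      (Matrix.isUnit_iff_isUnit_det _).mp (h.isUnit.pow _)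
    have h1 := Matrix.mul_nonsing_inv _ hu
    have h2 := Matrix.nonsing_inv_mul _ hu
    have hX : IsMoorePenrose (A ^ index A) (conjBlock U hts (T ^ index A)⁻¹ 0 0 0) := by
      rw [hA]
      refine ⟨?_, ?_, ?_, ?_⟩ <;>
        simp only [conjBlock_mul h.unitary, conjBlock_conjTranspose, Matrix.zero_mul,
          Matrix.mul_zero, add_zero, h1, h2, Matrix.one_mul, Matrix.conjTranspose_zero,
          Matrix.conjTranspose_one]
    rw [(moorePenrose_spec _).unique hX, hA, conjBlock_mul h.unitary, conjBlock_mul h.unitary,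
      h1, h2]
    simp

theorem eq_zero_of_weakCore_comm (h : IsCoreEPDecomposition A hts U T S N) (hk : 1 ≤ index A)
    (hw : A ^ index A * weakCore A = weakCore A * A ^ index A)
    (hd : A ^ index A * dualWeakCore A = dualWeakCore A * A ^ index A) : S = 0 := by
  obtain ⟨k, hk'⟩ := Nat.exists_eq_add_of_le' hk
  have hX := h.mul_coreEP_mul_coreEP
  -- With X the core EP inverse and W = X²A, AX² = X gives AW = XA, so left multiplication by A
  -- rewrites both hypotheses in terms of XA.
  have hAW : A * weakGroup A = coreEP A * A := by
    rw [weakGroup, sq]; simp only [← mul_assoc]; rw [hX]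
  have e1 : A ^ index A * (coreEP A * A) * projP A = coreEP A * A * A ^ index A := by
    calc _ = A * (A ^ index A * weakCore A) := by
          rw [weakCore, ← hAW]; simp only [← mul_assoc, ← pow_succ, ← pow_succ']
      _ = A * weakGroup A * (projP A * A ^ index A) := by
          rw [hw, weakCore]; simp only [mul_assoc]
      _ = _ := by rw [hAW, hk', pow_succ', ← mul_assoc (projP A), projP_mul]
  have e2 : A ^ index A * (coreEP A * A) = coreEP A * A * A ^ index A := by
    calc _ = A * (A ^ index A * weakGroup A) := by
          rw [← hAW]; simp only [← mul_assoc, ← pow_succ, ← pow_succ']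
      _ = A * (A ^ index A * dualWeakCore A) := by
          rw [dualWeakCore, ← mul_assoc (A ^ index A), hk', pow_succ, mul_assoc (A ^ k) A (projQ A),
            mul_projQ]
      _ = A * projQ A * weakGroup A * A ^ index A := by
          rw [hd, dualWeakCore]; simp only [mul_assoc]
      _ = _ := by rw [mul_projQ, hAW]
  have hXA : coreEP A * A = conjBlock U hts 1 (T⁻¹ * S) 0 0 := by
    rw [h.coreEP_eq]
    conv_lhs => rw [h.eq_conjBlock]
    rw [conjBlock_mul h.unitary]
    simp [h.inv_mul]
  obtain ⟨G, hG⟩ := exists_projP_conjBlock (hts := hts) (C := S) (E := N) h.unitary h.isUnit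
  rw [← h.eq_conjBlock] at hG
  have hk1 := h.pow_index_eq_zero
  -- The corners in `e2` give T T̃_k = T^k S. As N^k = 0, comparing the two recursions for T̃_(k+1)
  -- leaves T̃_k N = 0.
  have hSN : S * N = 0 := by
    rw [← tTilde_eq_zero_iff h.isUnit h.nilpotent hk, tTilde_mul_right]
    rw [hXA, h.pow_eq, conjBlock_mul h.unitary, conjBlock_mul h.unitary,
      conjBlock_inj h.unitary, hk1] at e2
    simp only [Matrix.zero_mul, Matrix.mul_zero, add_zero, Matrix.one_mul, and_true] at e2
    have e3 := congrArg (T * ·) e2.2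
    simp only [← Matrix.mul_assoc, ← pow_succ'] at e3
    rw [pow_succ, Matrix.mul_assoc _ T, h.mul_inv, Matrix.mul_one] at e3
    have e4 := tTilde_succ T S N (index A)
    rw [tTilde_succ', hk1, Matrix.mul_zero, add_zero, ← e3] at e4
    simpa using e4
  -- Now A^k XA P_A = A^k XA, where P_A is block diagonal with lower block NG. The corner on the
  -- left contains SN = 0; the one on the right is T^k T⁻¹ S.
  rw [← e2, hXA, h.pow_eq, hG, conjBlock_mul h.unitary, conjBlock_mul h.unitary,
    conjBlock_inj h.unitary, hk1] at e1
  have e3 := e1.2.1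
  simp only [Matrix.mul_zero, zero_add, add_zero] at e3
  rw [← Matrix.mul_assoc _ N, Matrix.mul_assoc _ _ N, Matrix.mul_assoc T⁻¹ S N, hSN, Matrix.mul_zero, Matrix.mul_zero, Matrix.zero_mul] at e3
  have e4 := eq_zero_of_isUnit_mul (h.isUnit.pow _) e3.symm
  exact eq_zero_of_isUnit_mul (Matrix.isUnit_nonsing_inv_iff.mpr h.isUnit) e4

theorem drazin_eq_coreEP (h : IsCoreEPDecomposition A hts U T S N) (hS : S = 0) :
    drazin A = coreEP A := by
  have hc : A * coreEP A = coreEP A * A := by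
    simpa using (h.pow_mul_coreEP_comm_iff le_rfl).mpr hS
  refine (drazin_spec A).unique ⟨?_, hc, ?_⟩
  · rw [← hc, h.mul_coreEP_mul_coreEP]
  · rw [pow_succ', ← mul_assoc, ← hc, h.mul_coreEP, h.pow_eq, conjBlock_mul h.unitary,
      h.pow_index_eq_zero]
    simp

theorem inverses_eq_coreEP (h : IsCoreEPDecomposition A hts U T S N) (hS : S = 0) :
    dmp A = coreEP A ∧ dualDMP A = coreEP A ∧ cmp A = coreEP A ∧ weakGroup A = coreEP A ∧
      mpcep A = coreEP A ∧ weakCore A = coreEP A ∧ dualWeakCore A = coreEP A := by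
  have hc : A * coreEP A = coreEP A * A := by
    simpa using (h.pow_mul_coreEP_comm_iff le_rfl).mpr hS
  have hX := h.mul_coreEP_mul_coreEP
  have hQ := projQ_mul_of_commute hX hc h.mul_coreEP_isHermitian
  have hP := mul_projP_of_commute hX hc h.mul_coreEP_isHermitian
  have hW : weakGroup A = coreEP A := by
    rw [weakGroup, sq, mul_assoc, ← hc, ← mul_assoc, ← hc, hX]
  simp only [cmp, dmp, dualDMP, mpcep, weakCore, dualWeakCore, hW, h.drazin_eq_coreEP hS, hP, hQ,
    and_self]

end IsCoreEPDecomposition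

end GenInv

/-! ### The equivalences, with S = 0 as the hub. -/

theorem theorem5p1 (n k : ℕ) (hk : 1 ≤ k) (A : Matrix (Fin n) (Fin n) ℂ)
    (hA : GenInv.index A = k)
    (t s : ℕ) (hts : t + s = n) (U : Matrix (Fin n) (Fin n) ℂ)
    (T : Matrix (Fin t) (Fin t) ℂ) (S : Matrix (Fin t) (Fin s) ℂ) (N : Matrix (Fin s) (Fin s) ℂ)
    (hdec : GenInv.IsCoreEPDecomposition A hts U T S N)
    (m : ℕ) (hm : 1 ≤ m) :
    List.TFAE [
      A ∈ GenInv.kCoreEPClass n k,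
      A ∈ GenInv.kIndexEPClass n k,
      A ∈ GenInv.mkCoreEPClass n m k,
      A ∈ GenInv.kMPCEPClass n k,
      A ∈ GenInv.kWCClass n k ∩ GenInv.dualKWCClass n k,
      ∀ j : ℕ, 1 ≤ j → A ^ j * GenInv.coreEP A = GenInv.coreEP A * A ^ j,
      ∃ j : ℕ, 1 ≤ j ∧ A ^ j * GenInv.coreEP A = GenInv.coreEP A * A ^ j,
      GenInv.coreEP A = GenInv.drazin A,
      ∀ j : ℕ, 1 ≤ j → A ^ j * GenInv.mpcep A = GenInv.mpcep A * A ^ j,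
      ∃ j : ℕ, 1 ≤ j ∧ A ^ j * GenInv.mpcep A = GenInv.mpcep A * A ^ j,
      GenInv.mpcep A = GenInv.drazin A,
      S = 0,
      GenInv.tTilde T S N k = 0,
      GenInv.tTilde T S N m = 0,
      GenInv.coreEP A = GenInv.drazin A ∧ GenInv.drazin A = GenInv.dmp A ∧
        GenInv.dmp A = GenInv.dualDMP A ∧ GenInv.dualDMP A = GenInv.cmp A ∧
        GenInv.cmp A = GenInv.weakGroup A ∧ GenInv.weakGroup A = GenInv.mpcep A ∧
        GenInv.mpcep A = GenInv.weakCore A ∧ GenInv.weakCore A = GenInv.dualWeakCore A] := by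
  have hcomm := fun (j : ℕ) (hj : 1 ≤ j) => hdec.pow_mul_coreEP_comm_iff hj
  have hD := hdec.drazin_eq_coreEP
  have hI := hdec.inverses_eq_coreEP
  -- An inverse equal to the Drazin inverse commutes with A, which is the case j = 1 of the
  -- commutation criteria.
  have hm1 : ∀ X, X = GenInv.drazin A → A * X = X * A := by
    rintro X rfl
    exact (GenInv.drazin_spec A).2.1
  tfae_have 1 ↔ 12 := (and_iff_right hA).trans (hcomm k hk)
  tfae_have 2 ↔ 12 := (and_iff_right hA).trans
    (by subst hA; exact hdec.pow_index_isEP_iff hk)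
  tfae_have 3 ↔ 12 := (and_iff_right hA).trans (hcomm m hm)
  tfae_have 4 → 12 := fun h => hdec.eq_zero_of_pow_mul_mpcep hk h.2
  tfae_have 5 → 12 := by
    rintro ⟨⟨-, hw⟩, -, hd⟩
    subst hA
    exact hdec.eq_zero_of_weakCore_comm hk hw hd
  tfae_have 12 → 6 := fun h j hj => (hcomm j hj).mpr h
  tfae_have 6 → 7 := fun h => ⟨1, le_rfl, h 1 le_rfl⟩
  tfae_have 7 → 12 := fun ⟨j, hj, h⟩ => (hcomm j hj).mp h
  tfae_have 8 → 12 := fun h => (hcomm 1 le_rfl).mp (by simpa using hm1 _ h)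
  tfae_have 12 → 15 := by
    intro h
    obtain ⟨h1, h2, h3, h4, h5, h6, h7⟩ := hI h
    simp only [h1, h2, h3, h4, h5, h6, h7, hD h, and_self]
  tfae_have 15 → 8 := fun h => h.1
  tfae_have 12 → 9 := fun h j hj => by
    rw [(hI h).2.2.2.2.1]
    exact (hcomm j hj).mpr h
  tfae_have 9 → 4 := fun h => ⟨hA, h k hk⟩
  tfae_have 9 → 10 := fun h => ⟨1, le_rfl, h 1 le_rfl⟩
  tfae_have 10 → 12 := fun ⟨j, hj, h⟩ => hdec.eq_zero_of_pow_mul_mpcep hj h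
  tfae_have 12 → 11 := fun h => by rw [(hI h).2.2.2.2.1, hD h]
  tfae_have 11 → 12 := fun h =>
    hdec.eq_zero_of_pow_mul_mpcep le_rfl (by simpa using hm1 _ h)
  tfae_have 12 → 5 := by
    intro h
    refine ⟨⟨hA, ?_⟩, hA, ?_⟩
    · rw [(hI h).2.2.2.2.2.1]
      exact (hcomm k hk).mpr h
    · rw [(hI h).2.2.2.2.2.2]
      exact (hcomm k hk).mpr h
  tfae_have 13 ↔ 12 := GenInv.tTilde_eq_zero_iff hdec.isUnit hdec.nilpotent hk
  tfae_have 14 ↔ 12 := GenInv.tTilde_eq_zero_iff hdec.isUnit hdec.nilpotent hm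
  tfae_finish
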